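/- Let $r,n\geq 1$, let $v\in\mathbb{C}^\times$ with a fixed square root $\sqrt v$, and let $g:\mathbb{Z}/n\mathbb{Z}\to\mathbb{C}$ satisfy $g(0)=-v$ and $g(a)g(-a)=v$ for $a\neq 0$. Let $z_i,z_j\in\mathbb{C}^\times$, put $\zeta_i=z_i^n$, $\zeta_j=z_j^n$, and assume $\zeta_i\neq v\zeta_j$. Let $V$ be the vector space with basis $v_A$ indexed by the ordered set of $r$ colors $c_1<\dots<c_r$ followed by $n$ scolors $w_0<\dots<w_{n-1}$, the scolor $w_x$ being identified with the integer $x$. **The fully-fused R-matrix** $R_{z_i,z_j}\in\mathrm{End}(V\otimes V)$ of the metaplectic Iwahori ice model is the following, for colors $a\ne b$ and scolors $x\neq y$, with $v_A\otimes v_B$ abbreviated $A\otimes B$: - $a\otimes a\mapsto(\zeta_i-v\zeta_j)\,a\otimes a$ and $x\otimes x\mapsto(\zeta_j-v\zeta_i)\,x\otimes x$; - $a\otimes b\mapsto \epsilon_{ab}(\zeta_i-\zeta_j)\,a\otimes b+(1-v)\eta_{ab}\,b\otimes a$, where $\epsilon_{ab}=v,\ \eta_{ab}=\zeta_i$ if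 $a<b$ and $\epsilon_{ab}=1,\ \eta_{ab}=\zeta_j$ if $a>b$; - $x\otimes y\mapsto g(y-x)(\zeta_i-\zeta_j)\,x\otimes y+(1-v)\eta_{xy}(z_j/z_i)^{y-x}\,y\otimes x$, where $\eta_{xy}=\zeta_i$ if $x<y$ and $\eta_{xy}=\zeta_j$ if $x>y$; - $x\otimes a\mapsto v(\zeta_i-\zeta_j)\,x\otimes a+(1-v)\zeta_j(z_i/z_j)^x\,a\otimes x$; - $a\otimes x\mapsto(\zeta_i-\zeta_j)\,a\otimes x+(1-v)\zeta_i(z_j/z_i)^x\,x\otimes a$. Let $R'$ be its matrix after the change of basis that replaces $v_x$ by $z_i^{-x}v_x$ in the first factor and by $z_j^{-x}v_x$ in the second factor for every scolor $x$, and keeps $v_a$ for every color $a$. **Kojima's R-matrix** $K(q,z)$ is, with colors odd ($[a]=1$), scolors even ($[x]=0$), and $A\neq B$ arbitrary basis labels: - $a\otimes a\mapsto -\,a\otimes a$ for a color $a$, and $x\otimes x\mapsto -\frac{q^2-z}{1-q^2z}\,x\otimes x$ for a scolor $x$; - $A\otimes B\mapsto\frac{(1-z)q}{1-q^2z}\,A\otimes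 B+(-1)^{[A][B]}\frac{(1-q^2)\,\theta_{AB}}{1-q^2z}\,B\otimes A$, where $\theta_{AB}=z$ if $A<B$ and $\theta_{AB}=1$ if $A>B$. For $R\in\mathrm{End}(V\otimes V)$ write $R^{u}$ for its ungraded version, in which every matrix entry all of whose four labels are colors is multiplied by $-1$. **The twist.** Let $$\phi(a,b)=\phi_{\sqrt v}(a,b)=\begin{cases}-1/\sqrt v& a,b\text{ colors},\ a>b\\ -\sqrt v& a,b\text{ colors},\ a<b\\ g(b-a)/\sqrt v& a\ne b\text{ scolors}\\ \sqrt v& a\text{ scolor},\ b\text{ color}\\ 1/\sqrt v& a\text{ color},\ b\text{ scolor}\\ 1& a=b.\end{cases}$$ Say that $R_2\in\mathrm{End}(V\otimes V)$ is the Drinfeld twist of $R_1$ by $\phi$ if $R_2=F_{21}R_1F^{-1}$ for some $F(v_a\otimes v_b)=f(a,b)\,v_a\otimes v_b$ with $FF_{21}=1$ and $\phi(a,b)=f(b,a)/f(a,b)$. **The quantum group.** For $q\ne0$ let $\nu_A=1$ for colors and $\nu_A=-1$ for scolors, and number the basis labels $1,\dots,N=r+n$ in their order, with $N+1:=1$.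 The evaluation module $V(\zeta)$ of $U_q(\widehat{\mathfrak{gl}}(r|n))$ is $V$ with $e_k\mapsto \zeta^{\delta_{k,N}}E_{k,k+1}$, $f_k\mapsto\nu_k\zeta^{-\delta_{k,N}}E_{k+1,k}$, $K_k\mapsto q^{\nu_kE_{kk}}$ for $1\le k\le N$. With $t_k=K_kK_{k+1}^{-1}$ the coproduct is $\Delta e_k=e_k\otimes1+t_k\otimes e_k$, $\Delta f_k=f_k\otimes t_k^{-1}+1\otimes f_k$, $\Delta K_k=K_k\otimes K_k$. All tensor products here are graded. An R-matrix of $U_q(\widehat{\mathfrak{gl}}(r|n))$ on $V(\zeta_i)\otimes V(\zeta_j)$ is a nonzero $R\in\mathrm{End}(V\otimes V)$ with $R\,\Delta(X)=\Delta^{\mathrm{op}}(X)\,R$ for all these generators $X$. **Proposition.** 1. $\phi(a,b)\phi(b,a)=1$ for all $a,b$. 2. $R'$ is obtained from $(\zeta_i-v\zeta_j)\,K(1/\sqrt v,\zeta_i/\zeta_j)^{u}$ by multiplying, for all $a,b$, the coefficient of $v_a\otimes v_b$ in the image of $v_a\otimes v_b$ by $\phi(a,b)$, and it is the Drinfeld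 twist of $(\zeta_i-v\zeta_j)\,K(1/\sqrt v,\zeta_i/\zeta_j)^{u}$ by $\phi$. 3. $K(-1/\sqrt v,\zeta_i/\zeta_j)$, which differs from $K(1/\sqrt v,\zeta_i/\zeta_j)$ only in the sign of the coefficients of $v_A\otimes v_B$ in the images of $v_A\otimes v_B$ for $A\neq B$, is an R-matrix of $U_{1/\sqrt v}(\widehat{\mathfrak{gl}}(r|n))$ on $V(\zeta_i)\otimes V(\zeta_j)$. For every R-matrix $R$ of $U_{1/\sqrt v}(\widehat{\mathfrak{gl}}(r|n))$ on $V(\zeta_i)\otimes V(\zeta_j)$ there is a constant $c\neq0$ such that $R'$ is the Drinfeld twist of $c\,R^{u}$ by $\phi_{-\sqrt v}$ (the function $\phi$ for the other square root of $v$). -/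

import Mathlib

open scoped Kronecker

namespace MetaplecticIce

noncomputable section

/-! ### Spins -/

/-- The set of states of a horizontal edge: the colors `c_1 < ⋯ < c_r` (here `Sum.inl i` is
`c_{i+1}`) and the scolors `w_0, …, w_{n-1}` (here `Sum.inr j` is `w_j`, identified with the
integer `j`). -/
abbrev Spin (r n : ℕ) : Type := Fin r ⊕ Fin n

/-- Endomorphisms of `V ⊗ V`, where `V` has basis the set of spins, as matrices.  The column is the
pair of indices of the input vector, the row is the pair of indices of the output vector. -/
abbrev End2 (r n : ℕ) : Type := Matrix (Spin r n × Spin r n) (Spin r n × Spin r n) ℂ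

/-! ### The fully-fused R-matrix of the metaplectic Iwahori ice model -/

/-- The Boltzmann weight of the fully-fused R-vertex `R_{z_i,z_j}` whose south-west, north-west,
north-east and south-east edges carry the given spins. -/
def fusedWeight {r n : ℕ} (v : ℂ) (g : ZMod n → ℂ) (zi zj : ℂ) :
    (sw nw ne se : Spin r n) → ℂ
  | .inl a, .inl b, .inl c, .inl d =>
      if a = b then (if c = a ∧ d = a then zi ^ n - v * zj ^ n else 0)
      else if c = a ∧ d = b then
        (if a < b then v * (zi ^ n - zj ^ n) else zi ^ n - zj ^ n)
      else if c = b ∧ d = a then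
        (if a < b then (1 - v) * zi ^ n else (1 - v) * zj ^ n)
      else 0
  | .inr x, .inr y, .inr c, .inr d =>
      if x = y then (if c = x ∧ d = x then zj ^ n - v * zi ^ n else 0)
      else if c = x ∧ d = y then
        g (((y : ℕ) : ZMod n) - ((x : ℕ) : ZMod n)) * (zi ^ n - zj ^ n)
      else if c = y ∧ d = x then
        (if x < y then (1 - v) * zi ^ n * (zj / zi) ^ (((y : ℕ) : ℤ) - ((x : ℕ) : ℤ))
          else (1 - v) * zj ^ n * (zj / zi) ^ (((y : ℕ) : ℤ) - ((x : ℕ) : ℤ)))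
      else 0
  | .inr x, .inl a, .inr c, .inl d =>
      if c = x ∧ d = a then v * (zi ^ n - zj ^ n) else 0
  | .inl a, .inr x, .inl c, .inr d =>
      if c = a ∧ d = x then zi ^ n - zj ^ n else 0
  | .inl a, .inr x, .inr c, .inl d =>
      if c = x ∧ d = a then (1 - v) * zi ^ n * (zj / zi) ^ (x : ℕ) else 0
  | .inr x, .inl a, .inl c, .inr d =>
      if c = a ∧ d = x then (1 - v) * zj ^ n * (zi / zj) ^ (x : ℕ) else 0
  | _, _, _, _ => 0

/-- The fully-fused R-matrix as an endomorphism of `V(z_i) ⊗ V(z_j)`.  The line with parameter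
`z_i` runs from south-west to north-east, the one with parameter `z_j` from north-west to
south-east. -/
def fusedR (r : ℕ) {n : ℕ} (v : ℂ) (g : ZMod n → ℂ) (zi zj : ℂ) : End2 r n :=
  Matrix.of fun out inp => fusedWeight v g zi zj inp.1 inp.2 out.1 out.2

/-- The factor by which the basis vector of `V(z)` labelled by a spin is rescaled, for a horizontal
edge attached to the left of a vertex with scolor `w`. -/
def basisScale {r n : ℕ} (w : ℤ) (z : ℂ) : Spin r n → ℂ
  | .inl _ => 1
  | .inr x => z ^ (w - ((x : ℕ) : ℤ) + 1 - (n : ℤ))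

/-- The matrix of an endomorphism of `V(z_i) ⊗ V(z_j)` in the rescaled bases; in the fully-fused
model `w = w_{n-1}`. -/
def changeBasis {r n : ℕ} (zi zj : ℂ) (R : End2 r n) : End2 r n :=
  let D : End2 r n := Matrix.diagonal fun p =>
    basisScale ((n : ℤ) - 1) zi p.1 * basisScale ((n : ℤ) - 1) zj p.2
  D⁻¹ * R * D

/-! ### Kojima's R-matrix -/

/-- The parity of a basis vector: colors are odd and scolors are even. -/
def parity {r n : ℕ} : Spin r n → ℕ
  | .inl _ => 1
  | .inr _ => 0

/-- The sign `ν`, equal to `1` for colors and to `-1` for scolors. -/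
def nu {r n : ℕ} : Spin r n → ℤ
  | .inl _ => 1
  | .inr _ => -1

/-- The position of a spin in the order `c_1 < ⋯ < c_r < w_0 < ⋯ < w_{n-1}`. -/
def pos {r n : ℕ} (a : Spin r n) : Fin (r + n) := finSumFinEquiv a

/-- Kojima's R-matrix `v_k ⊗ v_l ↦ ∑ R^{k l}_{i j} v_i ⊗ v_j`, a solution of the graded Yang-Baxter
equation, without its scalar prefactor. -/
def kojimaR (r n : ℕ) (q z : ℂ) : End2 r n :=
  Matrix.of fun out inp =>
    if inp.1 = inp.2 then
      (if out = inp then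
        (match inp.1 with
          | .inl _ => -1
          | .inr _ => -((q ^ 2 - z) / (1 - q ^ 2 * z)))
        else 0)
    else if out = inp then (1 - z) * q / (1 - q ^ 2 * z)
    else if out = inp.swap then
      (-1) ^ (parity inp.1 * parity inp.2) *
        (if pos out.1 < pos out.2 then (1 - q ^ 2) / (1 - q ^ 2 * z)
          else (1 - q ^ 2) * z / (1 - q ^ 2 * z))
    else 0

/-- Passage from the graded to the ungraded Yang-Baxter equation: the weights all of whose edges
are colors are multiplied by `-1`. -/
def ungrade {r n : ℕ} (R : End2 r n) : End2 r n :=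
  Matrix.of fun out inp =>
    if inp.1.isLeft ∧ inp.2.isLeft ∧ out.1.isLeft ∧ out.2.isLeft then -R out inp else R out inp

/-! ### The quantum affine superalgebra of `gl(r|n)` and its evaluation modules -/

/-- The cyclic successor of a spin in the order `c_1 < ⋯ < c_r < w_0 < ⋯ < w_{n-1}`. -/
def next {r n : ℕ} (a : Spin r n) : Spin r n :=
  finSumFinEquiv.symm (finRotate (r + n) (finSumFinEquiv a))

/-- Elements of `U_q` out of which the coproduct of the generators is built: the Chevalley
generators `e_k`, `f_k` (the node `k` of the affine Dynkin diagram joins `k` and `next k`; the last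
one is the affine node), the Cartan elements `K_a = q^{ν_a E_{aa}}`, and
`t_k = K_k K_{next k}⁻¹`. -/
inductive Letter (r n : ℕ) : Type
  | one
  | e (k : Spin r n)
  | f (k : Spin r n)
  | t (k : Spin r n)
  | tInv (k : Spin r n)
  | K (a : Spin r n)

namespace Letter

/-- The parity of an element. -/
def par {r n : ℕ} : Letter r n → ℕ
  | e k => parity k + parity (next k)
  | f k => parity k + parity (next k)
  | _ => 0

/-- The action of `K_a`. -/
def matK {r n : ℕ} (q : ℂ) (a : Spin r n) : Matrix (Spin r n) (Spin r n) ℂ :=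
  Matrix.diagonal fun b => if b = a then q ^ nu a else 1

/-- The action of `K_a⁻¹`. -/
def matKInv {r n : ℕ} (q : ℂ) (a : Spin r n) : Matrix (Spin r n) (Spin r n) ℂ :=
  Matrix.diagonal fun b => if b = a then q ^ (-nu a) else 1

/-- The power of the spectral parameter at the node `k`: `z` at the affine node, and `1` at the
others. -/
def affineFactor {r n : ℕ} (z : ℂ) (k : Spin r n) : ℂ :=
  if (pos k : ℕ) + 1 = r + n then z else 1

/-- The evaluation module `V(z)` of dimension `r + n`. -/
def ev {r n : ℕ} (q z : ℂ) : Letter r n → Matrix (Spin r n) (Spin r n) ℂ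
  | one => 1
  | e k => Matrix.single k (next k) (affineFactor z k)
  | f k => Matrix.single (next k) k ((nu k : ℂ) * (affineFactor z k)⁻¹)
  | t k => matK q k * matKInv q (next k)
  | tInv k => matKInv q k * matK q (next k)
  | K a => matK q a

end Letter

/-- The generators `e_k`, `f_k`, `K_a` of the quantum affine superalgebra. -/
inductive Gen (r n : ℕ) : Type
  | e (k : Spin r n)
  | f (k : Spin r n)
  | K (a : Spin r n)

/-- The coproduct on generators: `Δ e_k = e_k ⊗ 1 + t_k ⊗ e_k`, `Δ f_k = f_k ⊗ t_k⁻¹ + 1 ⊗ f_k`,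
`Δ K_a = K_a ⊗ K_a`, as a list of pure tensors to be summed. -/
def Gen.coproduct {r n : ℕ} : Gen r n → List (Letter r n × Letter r n)
  | .e k => [(.e k, .one), (.t k, .e k)]
  | .f k => [(.f k, .tInv k), (.one, .f k)]
  | .K a => [(.K a, .K a)]

/-- The action of `X ⊗ Y` on `V(x) ⊗ V(y)`, with the sign rule
`(X ⊗ Y) (u ⊗ u') = (-1)^{|Y| |u|} X u ⊗ Y u'`. -/
def tensorAct {r n : ℕ} (q x y : ℂ) (X Y : Letter r n) : End2 r n :=
  (X.ev q x * Matrix.diagonal fun a => (-1) ^ (Y.par * parity a)) ⊗ₖ Y.ev q y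

/-- The action of `Δ(X)` on `V(x) ⊗ V(y)`. -/
def coproductAct {r n : ℕ} (q x y : ℂ) (X : Gen r n) : End2 r n :=
  (X.coproduct.map fun p => tensorAct q x y p.1 p.2).sum

/-- The action of the opposite coproduct `Δᵒᵖ(X)` on `V(x) ⊗ V(y)`, where
`(X ⊗ Y)ᵒᵖ = (-1)^{|X| |Y|} Y ⊗ X`. -/
def opCoproductAct {r n : ℕ} (q x y : ℂ) (X : Gen r n) : End2 r n :=
  (X.coproduct.map fun p =>
    ((-1) ^ (p.1.par * p.2.par) : ℂ) • tensorAct q x y p.2 p.1).sum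

/-- `R` is an R-matrix of the quantum affine superalgebra `U_q` of `gl(r|n)` on the tensor product
`V(x) ⊗ V(y)` of evaluation modules: a nonzero operator with `R Δ(X) = Δᵒᵖ(X) R`. -/
def IsAffineRMatrix {r n : ℕ} (q x y : ℂ) (R : End2 r n) : Prop :=
  R ≠ 0 ∧ ∀ X : Gen r n, R * coproductAct q x y X = opCoproductAct q x y X * R

/-! ### Drinfeld twists -/

/-- The function `φ` parametrizing the twist; `s` is the chosen square root of `v`. -/
def phi {r n : ℕ} (s : ℂ) (g : ZMod n → ℂ) : Spin r n → Spin r n → ℂ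
  | .inl a, .inl b => if b < a then -1 / s else if a < b then -s else 1
  | .inr a, .inr b =>
      if a = b then 1 else g (((b : ℕ) : ZMod n) - ((a : ℕ) : ZMod n)) / s
  | .inr _, .inl _ => s
  | .inl _, .inr _ => 1 / s

/-- Rescaling by `φ(a,b)` the weight of the configuration in which `a` runs from south-west to
north-east and `b` from north-west to south-east, that is, of the coefficient of `v_a ⊗ v_b` in the
image of `v_a ⊗ v_b`. -/
def rescale {r n : ℕ} (φ : Spin r n → Spin r n → ℂ) (R : End2 r n) : End2 r n :=
  Matrix.of fun out inp => if out = inp then φ inp.1 inp.2 * R out inp else R out inp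

/-- `R'` is the Drinfeld twist `F₂₁ R F⁻¹` of `R` by an element `F` of the Cartan part, acting by
`F (v_a ⊗ v_b) = f(a,b) v_a ⊗ v_b`, with `F F₂₁ = 1` and `φ(a,b) = f(b,a) / f(a,b)`. (As `F` is
diagonal, `F₁₂ F₁₃ F₂₃ = F₂₃ F₁₃ F₁₂` holds automatically.) -/
def IsDrinfeldTwist {r n : ℕ} (φ : Spin r n → Spin r n → ℂ) (R R' : End2 r n) : Prop :=
  ∃ f : Spin r n → Spin r n → ℂ,
    (∀ a b, f a b * f b a = 1) ∧ (∀ a b, φ a b = f b a / f a b) ∧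
    R' = (Matrix.diagonal fun p => f p.2 p.1) * R * (Matrix.diagonal fun p => f p.1 p.2)⁻¹

end

end MetaplecticIce

open scoped Kronecker

namespace MetaplecticIce

noncomputable section

open Letter

/-! Write `x = ζ_i`, `y = ζ_j` and `o = c_1`; the quantum group has parameter `q = 1/√v`, so `ζ_i ≠
v ζ_j` says `y - q²x ≠ 0`. There are three independent ingredients.

Comparison with the model (`changeBasis_fusedR`). The rescaling of the scolor vectors absorbs the
powers of `z_j/z_i`, after which the swap weights agree with those of the ungraded Kojima matrix.
Its diagonal weights for distinct labels all become `±√v (ζ_i - ζ_j)`, and `φ` is the ratio to those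
of the model. Since `φ(a,b) φ(b,a) = 1`, a square root of `φ` gives a diagonal `F` with `F F₂₁ = 1`.
Conjugating by it multiplies diagonal entries by `φ` and leaves swap entries alone
(`isDrinfeldTwist_rescale`).

Existence (`isAffineRMatrix_kojimaR`). Both sides of the intertwining relation are evaluated on `v_a
⊗ v_b`. Only the coincidences of `a`, `b` with the two ends of the node, the parities and the cyclic
order matter, which leaves finitely many rational identities in `q`, `x`, `y`. They hold for
Kojima's matrix at `-q`.

Uniqueness (`IsAffineRMatrix.eq_smul_kojimaR`). The vector `o ⊗ o` generates the tensor product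
under `Δ` (`ket_mem_of_coproductAct_stable`), and up to scalars it is the only vector killed under
`Δᵒᵖ` by all the `e_k`, `f_k` that kill `o` (`eq_smul_ket_of_singular`). An R-matrix therefore
preserves its line, and the scalar there determines the R-matrix. Both facts use only `q, x, y ≠ 0`
and `y - q²x ≠ 0`; `q` may be a root of unity.

The sign of `q` in the existence step is why the final twist uses `-√v`: the comparison holds for
either square root of `v`, and `-(1/√v) = 1/(-√v)`. -/

/-- The basis vector `v_a ⊗ v_b`. -/
def ket {r n : ℕ} (a b : Spin r n) : Spin r n × Spin r n → ℂ := Pi.single (a, b) 1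

theorem ket_apply {r n : ℕ} (a b c d : Spin r n) :
    ket a b (c, d) = if c = a ∧ d = b then 1 else 0 := by
  simp [ket, Pi.single_apply]

theorem mulVec_ket_apply {r n : ℕ} (M : End2 r n) (a b : Spin r n) (p : Spin r n × Spin r n) :
    (M.mulVec (ket a b)) p = M p (a, b) := by
  simp [ket]

theorem end2_ext {r n : ℕ} {M N : End2 r n}
    (h : ∀ a b, M.mulVec (ket a b) = N.mulVec (ket a b)) : M = N := by
  ext p ⟨a, b⟩
  rw [← mulVec_ket_apply M, h, mulVec_ket_apply]

/-! ### Both coproducts on basis vectors and in coordinates -/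

theorem tensorAct_apply {r n : ℕ} (q x y : ℂ) (X Y : Letter r n) (a b c d : Spin r n) :
    tensorAct q x y X Y (c, d) (a, b) =
      X.ev q x c a * (-1) ^ (Y.par * parity a) * Y.ev q y d b := by
  simp [tensorAct, Matrix.kroneckerMap_apply]

/-- The eigenvalue of `t_k` on the basis vector labelled by `a`. -/
def tval {r n : ℕ} (q : ℂ) (k a : Spin r n) : ℂ :=
  (if a = k then q ^ nu k else 1) * (if a = next k then q ^ (-nu (next k)) else 1)

/-- The eigenvalue of `t_k⁻¹` on the basis vector labelled by `a`. -/
def tvalInv {r n : ℕ} (q : ℂ) (k a : Spin r n) : ℂ :=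
  (if a = k then q ^ (-nu k) else 1) * (if a = next k then q ^ nu (next k) else 1)

theorem ev_t {r n : ℕ} (q z : ℂ) (k : Spin r n) :
    (Letter.t k).ev q z = Matrix.diagonal (tval q k) := by
  simp [ev, matK, matKInv, tval, Matrix.diagonal_mul_diagonal]

theorem ev_tInv {r n : ℕ} (q z : ℂ) (k : Spin r n) :
    (Letter.tInv k).ev q z = Matrix.diagonal (tvalInv q k) := by
  simp [ev, matK, matKInv, tvalInv, Matrix.diagonal_mul_diagonal]

/-- The sign picked up when the odd or even generator at the node `k` passes `v_a`. -/
def crossSign {r n : ℕ} (k a : Spin r n) : ℂ := (-1) ^ ((parity k + parity (next k)) * parity a)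

theorem coproductAct_e_ket {r n : ℕ} (q x y : ℂ) (k a b : Spin r n) :
    (coproductAct q x y (.e k)).mulVec (ket a b) =
      (if a = next k then affineFactor x k else 0) • ket k b +
      (if b = next k then crossSign k a * tval q k a * affineFactor y k else 0) • ket a k := by
  ext ⟨c, d⟩
  rw [mulVec_ket_apply]
  simp only [coproductAct, Gen.coproduct, List.map_cons, List.map_nil, List.sum_cons,
    List.sum_nil, add_zero, Matrix.add_apply, tensorAct_apply, ev_t]
  simp only [ev, par, Matrix.single_apply, Matrix.one_apply, Matrix.diagonal_apply, Pi.add_apply,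
    Pi.smul_apply, ket_apply, smul_eq_mul, crossSign, zero_mul, pow_zero, mul_one]
  grind

theorem coproductAct_f_ket {r n : ℕ} (q x y : ℂ) (k a b : Spin r n) :
    (coproductAct q x y (.f k)).mulVec (ket a b) =
      (if a = k then nu k * (affineFactor x k)⁻¹ * tvalInv q k b else 0) • ket (next k) b +
      (if b = k then crossSign k a * (nu k * (affineFactor y k)⁻¹) else 0) • ket a (next k) := by
  ext ⟨c, d⟩
  rw [mulVec_ket_apply]
  simp only [coproductAct, Gen.coproduct, List.map_cons, List.map_nil, List.sum_cons,
    List.sum_nil, add_zero, Matrix.add_apply, tensorAct_apply, ev_tInv]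
  simp only [ev, par, Matrix.single_apply, Matrix.one_apply, Matrix.diagonal_apply, Pi.add_apply,
    Pi.smul_apply, ket_apply, smul_eq_mul, crossSign, zero_mul, pow_zero, mul_one]
  grind

theorem opCoproductAct_e_ket {r n : ℕ} (q x y : ℂ) (k a b : Spin r n) :
    (opCoproductAct q x y (.e k)).mulVec (ket a b) =
      (if a = next k then affineFactor x k * tval q k b else 0) • ket k b +
      (if b = next k then crossSign k a * affineFactor y k else 0) • ket a k := by
  ext ⟨c, d⟩
  rw [mulVec_ket_apply]
  simp only [opCoproductAct, Gen.coproduct, List.map_cons, List.map_nil, List.sum_cons,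
    List.sum_nil, add_zero, Matrix.add_apply, Matrix.smul_apply, tensorAct_apply, ev_t]
  simp only [ev, par, Matrix.single_apply, Matrix.one_apply, Matrix.diagonal_apply, Pi.add_apply,
    Pi.smul_apply, ket_apply, smul_eq_mul, crossSign, zero_mul, mul_zero, pow_zero, mul_one]
  grind

theorem opCoproductAct_f_ket {r n : ℕ} (q x y : ℂ) (k a b : Spin r n) :
    (opCoproductAct q x y (.f k)).mulVec (ket a b) =
      (if a = k then nu k * (affineFactor x k)⁻¹ else 0) • ket (next k) b +
      (if b = k then crossSign k a * tvalInv q k a * (nu k * (affineFactor y k)⁻¹) else 0) •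
        ket a (next k) := by
  ext ⟨c, d⟩
  rw [mulVec_ket_apply]
  simp only [opCoproductAct, Gen.coproduct, List.map_cons, List.map_nil, List.sum_cons,
    List.sum_nil, add_zero, Matrix.add_apply, Matrix.smul_apply, tensorAct_apply, ev_tInv]
  simp only [ev, par, Matrix.single_apply, Matrix.one_apply, Matrix.diagonal_apply, Pi.add_apply,
    Pi.smul_apply, ket_apply, smul_eq_mul, crossSign, zero_mul, mul_zero, pow_zero, mul_one]
  grind

/-- The eigenvalue of `K_c ⊗ K_c` on `v_a ⊗ v_b`. -/
def kval {r n : ℕ} (q : ℂ) (c a b : Spin r n) : ℂ :=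
  (if a = c then q ^ nu c else 1) * (if b = c then q ^ nu c else 1)

theorem coproductAct_K_ket {r n : ℕ} (q x y : ℂ) (k a b : Spin r n) :
    (coproductAct q x y (.K k)).mulVec (ket a b) = kval q k a b • ket a b := by
  ext ⟨c, d⟩
  rw [mulVec_ket_apply]
  simp only [coproductAct, Gen.coproduct, List.map_cons, List.map_nil, List.sum_cons,
    List.sum_nil, add_zero, tensorAct_apply]
  simp only [ev, par, matK, Matrix.diagonal_apply,
    Pi.smul_apply, ket_apply, smul_eq_mul, kval, zero_mul, pow_zero, mul_one]
  grind

theorem opCoproductAct_K {r n : ℕ} (q x y : ℂ) (k : Spin r n) :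
    opCoproductAct q x y (.K k) = coproductAct q x y (.K k) := by
  simp [opCoproductAct, coproductAct, Gen.coproduct, par]

theorem mulVec_eq_sum_ket {r n : ℕ} (M : End2 r n) (w : Spin r n × Spin r n → ℂ)
    (p : Spin r n × Spin r n) :
    M.mulVec w p = ∑ a, ∑ b, w (a, b) * M.mulVec (ket a b) p := by
  simp only [mulVec_ket_apply]
  simp only [Matrix.mulVec, dotProduct, Fintype.sum_prod_type, mul_comm]

/-- The coordinate form serves to solve linear equations for an unknown vector `w`: each coordinate
involves at most two coefficients of `w`. -/
theorem opCoproductAct_e_mulVec_apply {r n : ℕ} (q x y : ℂ) (k c d : Spin r n)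
    (w : Spin r n × Spin r n → ℂ) :
    (opCoproductAct q x y (.e k)).mulVec w (c, d) =
      (if c = k then affineFactor x k * tval q k d * w (next k, d) else 0) +
      (if d = k then crossSign k c * affineFactor y k * w (c, next k) else 0) := by
  rw [mulVec_eq_sum_ket]
  simp only [opCoproductAct_e_ket, Pi.add_apply, Pi.smul_apply, ket_apply, smul_eq_mul, mul_add,
    Finset.sum_add_distrib, ite_and, mul_ite, mul_zero, mul_one]
  congr 1
  · by_cases h : c = k <;> simp [h]
    ring
  · by_cases h : d = k <;> simp [h]
    ring

theorem opCoproductAct_f_mulVec_apply {r n : ℕ} (q x y : ℂ) (k c d : Spin r n)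
    (w : Spin r n × Spin r n → ℂ) :
    (opCoproductAct q x y (.f k)).mulVec w (c, d) =
      (if c = next k then nu k * (affineFactor x k)⁻¹ * w (k, d) else 0) +
      (if d = next k then crossSign k c * tvalInv q k c * (nu k * (affineFactor y k)⁻¹) * w (c, k)
        else 0) := by
  rw [mulVec_eq_sum_ket]
  simp only [opCoproductAct_f_ket, Pi.add_apply, Pi.smul_apply, ket_apply, smul_eq_mul, mul_add,
    Finset.sum_add_distrib, ite_and, mul_ite, mul_zero, mul_one]
  congr 1
  · by_cases h : c = next k <;> simp [h]
    ring
  · by_cases h : d = next k <;> simp [h]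
    ring

/-! ### The cyclic order on spins -/

theorem pos_injective {r n : ℕ} : Function.Injective (pos (r := r) (n := n)) :=
  finSumFinEquiv.injective

theorem pos_next {r n : ℕ} (k : Spin r n) : pos (next k) = finRotate (r + n) (pos k) := by
  simp [pos, next]

theorem val_pos_next {r n : ℕ} (k : Spin r n) :
    (pos (next k) : ℕ) = if (pos k : ℕ) + 1 = r + n then 0 else (pos k : ℕ) + 1 := by
  rw [pos_next]
  generalize pos k = i
  generalize r + n = N at i
  obtain _ | N := N
  · exact i.elim0
  · rw [coe_finRotate]
    simp [Fin.ext_iff]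

/-- With a single label the cyclic successor would be the identity; every case split below needs the
two ends of a node to differ. -/
theorem next_ne_self {r n : ℕ} (h : 2 ≤ r + n) (k : Spin r n) : next k ≠ k := by
  intro hk
  have h1 := val_pos_next k
  rw [hk] at h1
  split_ifs at h1 <;> omega

/-! ### Kojima's R-matrix intertwines -/

/-- `x` if `a` precedes `b`, and `y` otherwise. -/
def ordChoice {r n : ℕ} (x y : ℂ) (a b : Spin r n) : ℂ := if pos a < pos b then x else y

/-- The diagonal weight of Kojima's R-matrix on `v_a ⊗ v_a`, with denominators cleared. -/
def equalWeight {r n : ℕ} (q x y : ℂ) (a : Spin r n) : ℂ :=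
  if parity a = 1 then q ^ 2 * x - y else x - q ^ 2 * y

/-- The factor `y - q²x` is `y (1 - q²z)` at `z = x/y`, so it clears the common denominator and
makes all weights polynomial. -/
theorem smul_kojimaR_ket {r n : ℕ} {q x y : ℂ} (hy : y ≠ 0) (h : y - q ^ 2 * x ≠ 0)
    (a b : Spin r n) :
    ((y - q ^ 2 * x) • kojimaR r n q (x / y)).mulVec (ket a b) =
      if a = b then equalWeight q x y a • ket a a else
        ((y - x) * q) • ket a b +
          ((-1) ^ (parity a * parity b) * ((1 - q ^ 2) * ordChoice x y a b)) • ket b a := by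
  have h' : 1 - q ^ 2 * (x / y) ≠ 0 := by
    intro h0
    apply h
    field_simp at h0
    linear_combination h0
  ext ⟨c, d⟩
  rw [mulVec_ket_apply]
  simp only [Matrix.smul_apply, kojimaR, Matrix.of_apply, smul_eq_mul, Prod.mk.injEq,
    Prod.swap_prod_mk]
  by_cases hab : a = b
  · subst hab
    rcases a with a | a <;> simp only [if_true, equalWeight, parity, Pi.smul_apply, ket_apply,
      smul_eq_mul] <;> split_ifs <;> simp_all
    field_simp
    ring
  · simp only [if_neg hab, Pi.add_apply, Pi.smul_apply, ket_apply, smul_eq_mul]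
    by_cases h1 : c = a ∧ d = b
    · have h2 : ¬ (c = b ∧ d = a) := fun h2 => hab (h1.1.symm.trans h2.1)
      rw [if_pos h1, if_pos h1, if_neg h2]
      field_simp
      ring
    · rw [if_neg h1, if_neg h1]
      by_cases h2 : c = b ∧ d = a
      · obtain ⟨rfl, rfl⟩ := h2
        have hne : pos c ≠ pos d := fun hh => hab (pos_injective hh).symm
        simp only [and_self, if_true, ordChoice]
        rcases lt_or_gt_of_ne hne with hl | hl
        · rw [if_pos hl, if_neg hl.not_gt]
          field_simp
          ring
        · rw [if_neg hl.not_gt, if_pos hl]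
          field_simp
          ring
      · simp [h2]

theorem parity_nu_cases {r n : ℕ} (a : Spin r n) :
    (parity a = 1 ∧ nu a = 1) ∨ (parity a = 0 ∧ nu a = -1) := by
  rcases a with a | a <;> simp [parity, nu]

theorem affineFactor_of_ne {r n : ℕ} (z : ℂ) {k : Spin r n} (h : (pos k : ℕ) + 1 ≠ r + n) :
    affineFactor z k = 1 := if_neg h

theorem affineFactor_of_eq {r n : ℕ} (z : ℂ) {k : Spin r n} (h : (pos k : ℕ) + 1 = r + n) :
    affineFactor z k = z := if_pos h

/-- All that the intertwining relation needs from the order. At a finite node `k` and `next k` are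
adjacent, so a third label lies on the same side of both. At the affine node `k` is last and `next
k` is first, so a third label lies between them; the resulting exchange of `x` and `y` is
compensated by the spectral parameter in `affineFactor`. -/
theorem ordChoice_cases {r n : ℕ} (hN : 2 ≤ r + n) (x y : ℂ) (k : Spin r n) :
    ((∀ z, affineFactor z k = 1) ∧ ordChoice x y k (next k) = x ∧ ordChoice x y (next k) k = y ∧
      ∀ m, m ≠ k → m ≠ next k →
        (ordChoice x y m k = x ∧ ordChoice x y k m = y ∧
          ordChoice x y m (next k) = x ∧ ordChoice x y (next k) m = y) ∨
        (ordChoice x y m k = y ∧ ordChoice x y k m = x ∧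
          ordChoice x y m (next k) = y ∧ ordChoice x y (next k) m = x)) ∨
    ((∀ z, affineFactor z k = z) ∧ ordChoice x y k (next k) = y ∧ ordChoice x y (next k) k = x ∧
      ∀ m, m ≠ k → m ≠ next k →
        ordChoice x y m k = x ∧ ordChoice x y k m = y ∧
          ordChoice x y m (next k) = y ∧ ordChoice x y (next k) m = x) := by
  have hp := val_pos_next k
  simp only [ordChoice, Fin.lt_def]
  by_cases h : (pos k : ℕ) + 1 = r + n
  · right
    rw [if_pos h] at hp
    refine ⟨fun z => affineFactor_of_eq z h, if_neg (by omega), if_pos (by omega), ?_⟩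
    intro m hm hm'
    have h1 : (pos m : ℕ) ≠ pos k := fun e => hm (pos_injective (Fin.ext e))
    have h2 : (pos m : ℕ) ≠ pos (next k) := fun e => hm' (pos_injective (Fin.ext e))
    have := (pos m).2
    exact ⟨if_pos (by omega), if_neg (by omega), if_neg (by omega), if_pos (by omega)⟩
  · left
    rw [if_neg h] at hp
    refine ⟨fun z => affineFactor_of_ne z h, if_pos (by omega), if_neg (by omega), ?_⟩
    intro m hm hm'
    have h1 : (pos m : ℕ) ≠ pos k := fun e => hm (pos_injective (Fin.ext e))
    have h2 : (pos m : ℕ) ≠ pos (next k) := fun e => hm' (pos_injective (Fin.ext e))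
    rcases Nat.lt_or_gt_of_ne h1 with h3 | h3
    · left
      exact ⟨if_pos (by omega), if_neg (by omega), if_pos (by omega), if_neg (by omega)⟩
    · right
      exact ⟨if_neg (by omega), if_pos (by omega), if_neg (by omega), if_pos (by omega)⟩

set_option linter.unusedSimpArgs false in
set_option maxHeartbeats 2000000 in
theorem smul_kojimaR_mul_coproductAct_e {r n : ℕ} (hN : 2 ≤ r + n) {q x y : ℂ} (hq : q ≠ 0)
    (hy : y ≠ 0) (h : y - (-q) ^ 2 * x ≠ 0) (k : Spin r n) :
    ((y - (-q) ^ 2 * x) • kojimaR r n (-q) (x / y)) * coproductAct q x y (.e k) =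
      opCoproductAct q x y (.e k) * ((y - (-q) ^ 2 * x) • kojimaR r n (-q) (x / y)) := by
  apply end2_ext
  intro a b
  simp only [← Matrix.mulVec_mulVec, coproductAct_e_ket, smul_kojimaR_ket hy h, Matrix.mulVec_add,
    Matrix.mulVec_smul]
  have hne := next_ne_self hN k
  have hne' := hne.symm
  have ho := ordChoice_cases hN x y k
  have hk := parity_nu_cases k
  have hk' := parity_nu_cases (next k)
  by_cases ha : a = next k <;> by_cases hb : b = next k
  · subst ha hb
    simp only [if_true, if_neg hne, if_neg hne', Matrix.mulVec_smul, opCoproductAct_e_ket, tval,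
      crossSign, equalWeight]
    rcases ho with ⟨hA, h1, h2, -⟩ | ⟨hA, h1, h2, -⟩ <;> rcases hk with ⟨p1, n1⟩ | ⟨p1, n1⟩ <;>
    rcases hk' with ⟨p2, n2⟩ | ⟨p2, n2⟩ <;> simp [hA, h1, h2, p1, n1, p2, n2, hne, hne'] <;>
    match_scalars <;> field_simp <;> ring
  · by_cases hbk : b = k
    · subst ha hbk
      simp only [if_true, if_neg hne, if_neg hne', Matrix.mulVec_smul, Matrix.mulVec_add,
        opCoproductAct_e_ket, tval, crossSign, equalWeight]
      rcases ho with ⟨hA, h1, h2, -⟩ | ⟨hA, h1, h2, -⟩ <;> rcases hk with ⟨p1, n1⟩ | ⟨p1, n1⟩ <;>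
      rcases hk' with ⟨p2, n2⟩ | ⟨p2, n2⟩ <;> simp [hA, h1, h2, p1, n1, p2, n2, hne, hne'] <;>
      match_scalars <;> field_simp <;> ring
    -- The second label is away from the node: it is a spectator, whose parity and place in the
    -- order are the only data.
    · have hb' := Ne.symm hb
      have hbk' := Ne.symm hbk
      subst ha
      simp only [if_true, if_neg hb, if_neg hb', if_neg hbk, if_neg hbk', Matrix.mulVec_smul,
        Matrix.mulVec_add, opCoproductAct_e_ket, tval, crossSign, equalWeight]
      rcases parity_nu_cases b with ⟨p3, n3⟩ | ⟨p3, n3⟩ <;>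
      rcases ho with ⟨hA, h1, h2, ho⟩ | ⟨hA, h1, h2, ho⟩ <;>
      rcases hk with ⟨p1, n1⟩ | ⟨p1, n1⟩ <;> rcases hk' with ⟨p2, n2⟩ | ⟨p2, n2⟩ <;>
      specialize ho b hbk hb <;> try rcases ho with ho | ho
      all_goals
        simp [hA, ho, p1, n1, p2, n2, p3, n3, hne, hne', hb, hb', hbk, hbk'] <;>
        match_scalars <;> field_simp
  · by_cases hak : a = k
    · subst hb hak
      simp only [if_true, if_neg hne, if_neg hne', Matrix.mulVec_smul, Matrix.mulVec_add,
        opCoproductAct_e_ket, tval, crossSign, equalWeight]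
      rcases ho with ⟨hA, h1, h2, -⟩ | ⟨hA, h1, h2, -⟩ <;> rcases hk with ⟨p1, n1⟩ | ⟨p1, n1⟩ <;>
      rcases hk' with ⟨p2, n2⟩ | ⟨p2, n2⟩ <;> simp [hA, h1, h2, p1, n1, p2, n2, hne, hne'] <;>
      match_scalars <;> field_simp <;> ring
    · have ha' := Ne.symm ha
      have hak' := Ne.symm hak
      subst hb
      simp only [if_true, if_neg ha, if_neg ha', if_neg hak, if_neg hak', Matrix.mulVec_smul,
        Matrix.mulVec_add, opCoproductAct_e_ket, tval, crossSign, equalWeight]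
      rcases parity_nu_cases a with ⟨p3, n3⟩ | ⟨p3, n3⟩ <;>
      rcases ho with ⟨hA, h1, h2, ho⟩ | ⟨hA, h1, h2, ho⟩ <;>
      rcases hk with ⟨p1, n1⟩ | ⟨p1, n1⟩ <;> rcases hk' with ⟨p2, n2⟩ | ⟨p2, n2⟩ <;>
      specialize ho a hak ha <;> try rcases ho with ho | ho
      all_goals
        simp [hA, ho, p1, n1, p2, n2, p3, n3, hne, hne', ha, ha', hak, hak'] <;>
        match_scalars <;> field_simp
  -- `e_k` kills both factors, and the matrix only permutes them, so both sides vanish.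
  · by_cases hab : a = b
    · subst hab
      simp [ha, opCoproductAct_e_ket, Matrix.mulVec_smul]
    · simp [ha, hb, hab, opCoproductAct_e_ket, Matrix.mulVec_smul, Matrix.mulVec_add,
        Matrix.mulVec_neg]

set_option linter.unusedSimpArgs false in
set_option maxHeartbeats 2000000 in
theorem smul_kojimaR_mul_coproductAct_f {r n : ℕ} (hN : 2 ≤ r + n) {q x y : ℂ} (hq : q ≠ 0)
    (hx : x ≠ 0) (hy : y ≠ 0) (h : y - (-q) ^ 2 * x ≠ 0) (k : Spin r n) :
    ((y - (-q) ^ 2 * x) • kojimaR r n (-q) (x / y)) * coproductAct q x y (.f k) =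
      opCoproductAct q x y (.f k) * ((y - (-q) ^ 2 * x) • kojimaR r n (-q) (x / y)) := by
  apply end2_ext
  intro a b
  simp only [← Matrix.mulVec_mulVec, coproductAct_f_ket, smul_kojimaR_ket hy h, Matrix.mulVec_add,
    Matrix.mulVec_smul]
  have hne := next_ne_self hN k
  have hne' := hne.symm
  have ho := ordChoice_cases hN x y k
  have hk := parity_nu_cases k
  have hk' := parity_nu_cases (next k)
  by_cases ha : a = k <;> by_cases hb : b = k
  · obtain rfl := ha
    obtain rfl := hb
    simp only [if_true, if_neg hne, if_neg hne', Matrix.mulVec_smul, opCoproductAct_f_ket, tvalInv,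
      crossSign, equalWeight]
    rcases ho with ⟨hA, h1, h2, -⟩ | ⟨hA, h1, h2, -⟩ <;> rcases hk with ⟨p1, n1⟩ | ⟨p1, n1⟩ <;>
    rcases hk' with ⟨p2, n2⟩ | ⟨p2, n2⟩ <;> simp [hA, h1, h2, p1, n1, p2, n2, hne, hne'] <;>
    match_scalars <;> field_simp <;> ring
  · by_cases hbk : b = next k
    · obtain rfl := ha
      obtain rfl := hbk
      simp only [if_true, if_neg hne, if_neg hne', Matrix.mulVec_smul, Matrix.mulVec_add,
        opCoproductAct_f_ket, tvalInv, crossSign, equalWeight]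
      rcases ho with ⟨hA, h1, h2, -⟩ | ⟨hA, h1, h2, -⟩ <;> rcases hk with ⟨p1, n1⟩ | ⟨p1, n1⟩ <;>
      rcases hk' with ⟨p2, n2⟩ | ⟨p2, n2⟩ <;> simp [hA, h1, h2, p1, n1, p2, n2, hne, hne'] <;>
      match_scalars <;> field_simp <;> ring
    · have hb' := Ne.symm hb
      have hbk' := Ne.symm hbk
      obtain rfl := ha
      simp only [if_true, if_neg hb, if_neg hb', if_neg hbk, if_neg hbk', Matrix.mulVec_smul,
        Matrix.mulVec_add, opCoproductAct_f_ket, tvalInv, crossSign, equalWeight]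
      rcases parity_nu_cases b with ⟨p3, n3⟩ | ⟨p3, n3⟩ <;>
      rcases ho with ⟨hA, h1, h2, ho⟩ | ⟨hA, h1, h2, ho⟩ <;>
      rcases hk with ⟨p1, n1⟩ | ⟨p1, n1⟩ <;> rcases hk' with ⟨p2, n2⟩ | ⟨p2, n2⟩ <;>
      specialize ho b hb hbk <;> try rcases ho with ho | ho
      all_goals
        simp [hA, ho, p1, n1, p2, n2, p3, n3, hne, hne', hb, hb', hbk, hbk'] <;>
        match_scalars <;> field_simp
  · by_cases hak : a = next k
    · obtain rfl := hb
      obtain rfl := hak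
      simp only [if_true, if_neg hne, if_neg hne', Matrix.mulVec_smul, Matrix.mulVec_add,
        opCoproductAct_f_ket, tvalInv, crossSign, equalWeight]
      rcases ho with ⟨hA, h1, h2, -⟩ | ⟨hA, h1, h2, -⟩ <;> rcases hk with ⟨p1, n1⟩ | ⟨p1, n1⟩ <;>
      rcases hk' with ⟨p2, n2⟩ | ⟨p2, n2⟩ <;> simp [hA, h1, h2, p1, n1, p2, n2, hne, hne'] <;>
      match_scalars <;> field_simp <;> ring
    · have ha' := Ne.symm ha
      have hak' := Ne.symm hak
      obtain rfl := hb
      simp only [if_true, if_neg ha, if_neg ha', if_neg hak, if_neg hak', Matrix.mulVec_smul,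
        Matrix.mulVec_add, opCoproductAct_f_ket, tvalInv, crossSign, equalWeight]
      rcases parity_nu_cases a with ⟨p3, n3⟩ | ⟨p3, n3⟩ <;>
      rcases ho with ⟨hA, h1, h2, ho⟩ | ⟨hA, h1, h2, ho⟩ <;>
      rcases hk with ⟨p1, n1⟩ | ⟨p1, n1⟩ <;> rcases hk' with ⟨p2, n2⟩ | ⟨p2, n2⟩ <;>
      specialize ho a ha hak <;> try rcases ho with ho | ho
      all_goals
        simp [hA, ho, p1, n1, p2, n2, p3, n3, hne, hne', ha, ha', hak, hak'] <;>
        match_scalars <;> field_simp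
  · by_cases hab : a = b
    · subst hab
      simp [ha, opCoproductAct_f_ket, Matrix.mulVec_smul]
    · simp [ha, hb, hab, opCoproductAct_f_ket, Matrix.mulVec_smul, Matrix.mulVec_add,
        Matrix.mulVec_neg]

/-- `v_a ⊗ v_b` and `v_b ⊗ v_a` have the same weight, and the matrix preserves their span. -/
theorem smul_kojimaR_mul_coproductAct_K {r n : ℕ} {q x y : ℂ} (q' : ℂ)
    (hy : y ≠ 0) (h : y - q' ^ 2 * x ≠ 0) (k : Spin r n) :
    ((y - q' ^ 2 * x) • kojimaR r n q' (x / y)) * coproductAct q x y (.K k) =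
      opCoproductAct q x y (.K k) * ((y - q' ^ 2 * x) • kojimaR r n q' (x / y)) := by
  apply end2_ext
  intro a b
  rw [opCoproductAct_K]
  simp only [← Matrix.mulVec_mulVec, coproductAct_K_ket, smul_kojimaR_ket hy h, Matrix.mulVec_smul]
  by_cases hab : a = b
  · subst hab
    simp only [if_true, Matrix.mulVec_smul, coproductAct_K_ket]
    exact smul_comm _ _ _
  · have hs : kval q k b a = kval q k a b := mul_comm _ _
    simp only [if_neg hab, Matrix.mulVec_smul, Matrix.mulVec_add, coproductAct_K_ket, hs]
    module

theorem isAffineRMatrix_kojimaR {r n : ℕ} (hN : 2 ≤ r + n) {q x y : ℂ} (hq : q ≠ 0) (hx : x ≠ 0)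
    (hy : y ≠ 0) (h : y - q ^ 2 * x ≠ 0) (hr : 0 < r) :
    IsAffineRMatrix q x y (kojimaR r n (-q) (x / y)) := by
  have h' : y - (-q) ^ 2 * x ≠ 0 := by rwa [neg_sq]
  refine ⟨fun h0 => ?_, fun X => ?_⟩
  -- The weight of `v_{c_1} ⊗ v_{c_1}` is `-1`, so the matrix is nonzero.
  · have := congrFun (congrFun h0 (.inl ⟨0, hr⟩, .inl ⟨0, hr⟩)) (.inl ⟨0, hr⟩, .inl ⟨0, hr⟩)
    simp [kojimaR] at this
  · apply smul_right_injective _ h'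
    change (y - (-q) ^ 2 * x) • (_ * _) = (y - (-q) ^ 2 * x) • (_ * _)
    rw [← Matrix.smul_mul, ← Matrix.mul_smul]
    cases X with
    | e k => exact smul_kojimaR_mul_coproductAct_e hN hq hy h' k
    | f k => exact smul_kojimaR_mul_coproductAct_f hN hq hx hy h' k
    | K k => exact smul_kojimaR_mul_coproductAct_K (-q) hy h' k

/-! ### Cyclicity of the highest weight vector -/

/-- The spin in a given position. -/
def spinAt {r n : ℕ} (i : ℕ) (hi : i < r + n) : Spin r n := finSumFinEquiv.symm ⟨i, hi⟩

theorem pos_spinAt {r n : ℕ} (i : ℕ) (hi : i < r + n) :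
    pos (spinAt i hi : Spin r n) = ⟨i, hi⟩ := by
  simp [pos, spinAt]

theorem spinAt_pos {r n : ℕ} (a : Spin r n) : spinAt (pos a : ℕ) (pos a).2 = a := by
  simp [pos, spinAt]

theorem exists_spinAt_eq {r n : ℕ} (a : Spin r n) : ∃ i, ∃ hi : i < r + n, spinAt i hi = a :=
  ⟨_, _, spinAt_pos a⟩

theorem spinAt_inj {r n : ℕ} {i j : ℕ} {hi : i < r + n} {hj : j < r + n} :
    (spinAt i hi : Spin r n) = spinAt j hj ↔ i = j := by
  simp [spinAt]

theorem next_spinAt {r n : ℕ} (i : ℕ) (hi : i + 1 < r + n) :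
    next (spinAt i (Nat.lt_of_succ_lt hi) : Spin r n) = spinAt (i + 1) hi := by
  apply pos_injective
  apply Fin.ext
  rw [val_pos_next]
  simp [pos_spinAt, hi.ne]

theorem next_spinAt_last {r n : ℕ} (i : ℕ) (hi : i + 1 = r + n) :
    next (spinAt i (by omega) : Spin r n) = spinAt 0 (by omega) := by
  apply pos_injective
  apply Fin.ext
  rw [val_pos_next]
  simp [pos_spinAt, hi]

theorem spinAt_zero {r n : ℕ} (hr : 0 < r) :
    (spinAt 0 (by omega) : Spin r n) = .inl ⟨0, hr⟩ := by
  apply pos_injective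
  rw [pos_spinAt]
  simp [pos]

theorem spinAt_last {r n : ℕ} (hn : 0 < n) :
    (spinAt (r + n - 1) (by omega) : Spin r n) = .inr ⟨n - 1, by omega⟩ := by
  apply pos_injective
  rw [pos_spinAt]
  simp [pos, Fin.ext_iff]
  omega

theorem affineFactor_spinAt {r n : ℕ} (z : ℂ) (i : ℕ) (hi : i + 1 < r + n) :
    affineFactor z (spinAt i (Nat.lt_of_succ_lt hi) : Spin r n) = 1 :=
  affineFactor_of_ne z (by simp [pos_spinAt, hi.ne])

theorem affineFactor_spinAt_last {r n : ℕ} (z : ℂ) (i : ℕ) (hi : i + 1 = r + n) :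
    affineFactor z (spinAt i (by omega) : Spin r n) = z :=
  affineFactor_of_eq z (by simp [pos_spinAt, hi])

theorem nu_ne_zero {r n : ℕ} (a : Spin r n) : (nu a : ℂ) ≠ 0 := by
  rcases a with a | a <;> simp [nu]

theorem tval_ne_zero {r n : ℕ} {q : ℂ} (hq : q ≠ 0) (k a : Spin r n) : tval q k a ≠ 0 := by
  unfold tval
  apply mul_ne_zero <;> split_ifs <;> simp [hq, zpow_ne_zero]

theorem tvalInv_ne_zero {r n : ℕ} {q : ℂ} (hq : q ≠ 0) (k a : Spin r n) :
    tvalInv q k a ≠ 0 := by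
  unfold tvalInv
  apply mul_ne_zero <;> split_ifs <;> simp [hq, zpow_ne_zero]

theorem crossSign_ne_zero {r n : ℕ} (k a : Spin r n) : crossSign k a ≠ 0 := by
  simp [crossSign]

theorem affineFactor_ne_zero {r n : ℕ} {z : ℂ} (hz : z ≠ 0) (k : Spin r n) :
    affineFactor z k ≠ 0 := by
  unfold affineFactor
  split_ifs <;> simp [hz]

/-- If `x ≠ q⁻² y`, the vector `v_{c_1} ⊗ v_{c_1}` generates `V(x) ⊗ V(y)`. -/
theorem ket_mem_of_coproductAct_stable {r n : ℕ} (hr : 0 < r) (hn : 0 < n) {q x y : ℂ} (hq : q ≠ 0)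
    (h : y - q ^ 2 * x ≠ 0)
    (W : Submodule ℂ (Spin r n × Spin r n → ℂ))
    (hW : ∀ X, ∀ w ∈ W, (coproductAct q x y X).mulVec w ∈ W)
    (h0 : ket (.inl ⟨0, hr⟩) (.inl ⟨0, hr⟩) ∈ W) (a b : Spin r n) : ket a b ∈ W := by
  rw [← spinAt_zero hr] at h0
  set o : Spin r n := spinAt 0 (by omega) with ho
  have po : parity o = 1 := by rw [ho, spinAt_zero hr]; rfl
  have no : nu o = 1 := by rw [ho, spinAt_zero hr]; rfl
  have pow_sq : ∀ a : Spin r n, ((-1 : ℂ) ^ parity a) * (-1) ^ parity a = 1 := fun a => by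
    rcases parity_nu_cases a with ⟨p, -⟩ | ⟨p, -⟩ <;> simp [p]
  -- the combination of `v_k ⊗ v_o` and `v_o ⊗ v_k` reached by the finite lowering operators
  have hu : ∀ k (hk : k + 1 < r + n), q⁻¹ • ket (spinAt (k + 1) hk) o -
      (-1 : ℂ) ^ parity (spinAt (k + 1) hk : Spin r n) • ket o (spinAt (k + 1) hk) ∈ W := by
    intro k
    induction k with
    | zero =>
      intro hk
      have h1 := hW (.f o) _ h0
      have hno : next o = spinAt 1 hk := next_spinAt 0 hk
      have hne : o ≠ spinAt 1 hk := by simp [ho, spinAt_inj]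
      have hA : ∀ z, affineFactor z o = 1 := fun z => affineFactor_spinAt z 0 hk
      rw [coproductAct_f_ket] at h1
      convert h1 using 1
      simp only [if_true, hno, tvalInv, if_neg hne, crossSign, po, no, hA]
      simp [pow_add, sub_eq_add_neg]
    | succ k ih =>
      intro hk
      have h1 := hW (.f (spinAt (k + 1) (by omega))) _ (ih (by omega))
      rw [Matrix.mulVec_sub, Matrix.mulVec_smul, Matrix.mulVec_smul, coproductAct_f_ket,
        coproductAct_f_ket] at h1
      have hne : o ≠ spinAt (k + 1) (by omega) := by simp [ho, spinAt_inj]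
      have hne' : o ≠ spinAt (k + 1 + 1) hk := by simp [ho, spinAt_inj]
      simp only [if_true, if_neg hne, next_spinAt (k + 1) hk, tvalInv, if_neg hne', crossSign,
        affineFactor_spinAt _ (k + 1) hk, po, zero_smul, add_zero, zero_add, inv_one, mul_one,
        pow_add] at h1
      have h2 := W.smul_mem (nu (spinAt (k + 1) (by omega) : Spin r n) : ℂ)⁻¹ h1
      convert h2 using 1
      have h3 := nu_ne_zero (spinAt (k + 1) (by omega) : Spin r n)
      have h4 := pow_sq (spinAt (k + 1) (by omega) : Spin r n)
      match_scalars
      · field_simp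
      · generalize (-1 : ℂ) ^ parity (spinAt (k + 1) (by omega) : Spin r n) = α at *
        field_simp
        linear_combination h4
  obtain ⟨L, hL⟩ : ∃ L, L + 1 + 1 = r + n := ⟨r + n - 2, by omega⟩
  have hlast : (spinAt (L + 1) (by omega) : Spin r n) = .inr ⟨n - 1, by omega⟩ := by
    rw [← spinAt_last hn, spinAt_inj]; omega
  have pl : parity (spinAt (L + 1) (by omega) : Spin r n) = 0 := by rw [hlast]; rfl
  have hnl : next (spinAt (L + 1) (by omega) : Spin r n) = o := next_spinAt_last (L + 1) hL
  have hnelast : o ≠ spinAt (L + 1) (by omega) := by simp [ho, spinAt_inj]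
  -- The affine raising operator sends `o ⊗ o` to `x (last ⊗ o) - q⁻¹ y (o ⊗ last)`, while `hu`
  -- gives `q⁻¹ (last ⊗ o) - o ⊗ last`. The determinant of the two combinations is a nonzero
  -- multiple of `y - q²x`, so both vectors are in `W`.
  have hlastmem : ket (spinAt (L + 1) (by omega)) o ∈ W ∧ ket o (spinAt (L + 1) (by omega)) ∈ W := by
    have h1 := hu L (by omega)
    have h2 := hW (.e (spinAt (L + 1) (by omega))) _ h0
    rw [coproductAct_e_ket] at h2
    simp only [hnl, if_true, affineFactor_spinAt_last _ (L + 1) hL, crossSign, tval, pl, po, no,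
      if_neg hnelast] at h2
    rw [pl] at h1
    have h3 : ket o (spinAt (L + 1) (by omega)) ∈ W := by
      have h4 := W.smul_mem (y - q ^ 2 * x)⁻¹
        (W.sub_mem (W.smul_mem (x * q ^ 2) h1) (W.smul_mem q h2))
      convert h4 using 1
      match_scalars
      · field_simp
        simp
        ring
      · field_simp
        ring
    refine ⟨?_, h3⟩
    have h4 := W.smul_mem q (W.add_mem h1 h3)
    convert h4 using 1
    match_scalars <;> field_simp <;> simp
  -- the finite raising operators separate the two terms in the other positions
  have hdown : ∀ j k (hk : k + 1 < r + n), k + j = L →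
      ket (spinAt (k + 1) hk) o ∈ W ∧ ket o (spinAt (k + 1) hk) ∈ W := by
    intro j
    induction j with
    | zero =>
      intro k hk hkL
      obtain rfl : k = L := hkL
      exact hlastmem
    | succ j ih =>
      intro k hk hkL
      obtain ⟨h1, h2⟩ := ih (k + 1) (by omega) (by omega)
      have h1 := hW (.e (spinAt (k + 1) hk)) _ h1
      have h2 := hW (.e (spinAt (k + 1) hk)) _ h2
      have hk2 : k + 1 + 1 < r + n := by omega
      have hne' : o ≠ spinAt (k + 1 + 1) hk2 := by simp [ho, spinAt_inj]
      rw [coproductAct_e_ket] at h1 h2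
      simp only [next_spinAt (k + 1) hk2, if_true, if_neg hne',
        affineFactor_spinAt _ (k + 1) hk2, zero_smul, add_zero, zero_add, one_smul] at h1 h2
      refine ⟨h1, (W.smul_mem_iff ?_).1 h2⟩
      exact mul_ne_zero (mul_ne_zero (crossSign_ne_zero _ _) (tval_ne_zero hq _ _)) one_ne_zero
  -- Induction on the first factor: `f_l` applied to `v_l ⊗ v_b` is a nonzero multiple of `v_{l+1} ⊗
  -- v_b`, plus a multiple of `v_l ⊗ v_{l+1}` that is already in `W`.
  have hall : ∀ l (hl : l < r + n) (b : Spin r n), ket (spinAt l hl) b ∈ W := by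
    intro l
    induction l with
    | zero =>
      intro hl b
      obtain ⟨m, hb, rfl⟩ := exists_spinAt_eq b
      rcases m with _ | m
      · exact h0
      · exact (hdown (L - m) m hb (by omega)).2
    | succ l ih =>
      intro hl b
      have hl' : l < r + n := by omega
      have h1 := hW (.f (spinAt l hl')) _ (ih hl' b)
      rw [coproductAct_f_ket, next_spinAt l hl] at h1
      have h2 := W.smul_mem
        (if b = spinAt l hl' then crossSign (spinAt l hl') (spinAt l hl') *
          (nu (spinAt l hl' : Spin r n) *
            (affineFactor y (spinAt l hl' : Spin r n))⁻¹) else 0)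
        (ih hl' (spinAt (l + 1) hl))
      have h3 := (W.add_mem_iff_left h2).1 h1
      rw [if_pos rfl, affineFactor_spinAt x l hl] at h3
      refine (W.smul_mem_iff ?_).1 h3
      exact mul_ne_zero (by simpa using nu_ne_zero _) (tvalInv_ne_zero hq _ _)
  rw [← spinAt_pos a]
  exact hall _ _ _

/-! ### Singular vectors -/

/-- A vector of `V(x) ⊗ V(y)` killed, under the opposite coproduct, by all the raising and lowering
operators that kill `v_{c_1}` is a multiple of `v_{c_1} ⊗ v_{c_1}`. -/
theorem eq_smul_ket_of_singular {r n : ℕ} (hr : 0 < r) (hn : 0 < n) {q x y : ℂ} (hq : q ≠ 0)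
    (hx : x ≠ 0) (hy : y ≠ 0) (h : y - q ^ 2 * x ≠ 0) (w : Spin r n × Spin r n → ℂ)
    (he : ∀ k : Spin r n, next k ≠ .inl ⟨0, hr⟩ → (opCoproductAct q x y (.e k)).mulVec w = 0)
    (hf : ∀ k : Spin r n, k ≠ .inl ⟨0, hr⟩ → (opCoproductAct q x y (.f k)).mulVec w = 0) :
    w = w (.inl ⟨0, hr⟩, .inl ⟨0, hr⟩) • ket (.inl ⟨0, hr⟩) (.inl ⟨0, hr⟩) := by
  simp only [← spinAt_zero (n := n) hr] at *
  set o : Spin r n := spinAt 0 (by omega) with ho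
  have po : parity o = 1 := by rw [ho, spinAt_zero hr]; rfl
  have no : nu o = 1 := by rw [ho, spinAt_zero hr]; rfl
  have hE : ∀ i (hi : i + 1 < r + n) (c d : Spin r n), _ = (0 : ℂ) := fun i hi c d =>
    (opCoproductAct_e_mulVec_apply q x y (spinAt i (by omega)) c d w).symm.trans
      (congrFun (he (spinAt i (by omega)) (by rw [next_spinAt i hi]; simp [ho, spinAt_inj])) (c, d))
  -- The condition on `d` leaves a single term in the coordinate `(i, d)` of the equation for `e_i`.
  have hleft : ∀ i (hi : i + 1 < r + n) (d : Spin r n), d ≠ spinAt i (by omega) →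
      w (spinAt (i + 1) hi, d) = 0 := by
    intro i hi d hd
    have h1 := hE i hi (spinAt i (by omega)) d
    rw [if_pos rfl, if_neg hd, add_zero, next_spinAt i hi] at h1
    refine (mul_eq_zero.1 h1).resolve_left ?_
    exact mul_ne_zero (affineFactor_ne_zero hx _) (tval_ne_zero hq _ _)
  have hright : ∀ i (hi : i + 1 < r + n) (c : Spin r n), c ≠ spinAt i (by omega) →
      w (c, spinAt (i + 1) hi) = 0 := by
    intro i hi c hc
    have h1 := hE i hi c (spinAt i (by omega))
    rw [if_neg hc, if_pos rfl, zero_add, next_spinAt i hi] at h1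
    refine (mul_eq_zero.1 h1).resolve_left ?_
    exact mul_ne_zero (crossSign_ne_zero _ _) (affineFactor_ne_zero hy _)
  have h2 : 0 + 1 < r + n := by omega
  have hne : o ≠ spinAt (0 + 1) h2 := by simp [ho, spinAt_inj]
  have hno : next o = spinAt (0 + 1) h2 := next_spinAt 0 h2
  -- `hleft` and `hright` together miss only the positions `(0,0)`, `(1,0)` and `(0,1)`. With at
  -- least three labels, `f_1` moves position 1 to position 2 and isolates the last two
  -- coefficients. With two labels `f_1` is affine, and its equation and that of `e_0` form a 2 × 2
  -- system with determinant `±(y - q²x)`.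
  have hpair : w (spinAt (0 + 1) h2, o) = 0 ∧ w (o, spinAt (0 + 1) h2) = 0 := by
    by_cases h3 : 1 + 1 < r + n
    · have hF : ∀ c d : Spin r n, _ = (0 : ℂ) := fun c d =>
        (opCoproductAct_f_mulVec_apply q x y (spinAt (0 + 1) h2) c d w).symm.trans
          (congrFun (hf (spinAt (0 + 1) h2) hne.symm) (c, d))
      have hne2 : o ≠ spinAt (1 + 1) h3 := by simp [ho, spinAt_inj]
      constructor
      · have h4 := hF (spinAt (1 + 1) h3) o
        rw [next_spinAt (0 + 1) h3, if_pos rfl, if_neg hne2, add_zero] at h4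
        refine (mul_eq_zero.1 h4).resolve_left ?_
        exact mul_ne_zero (nu_ne_zero _) (inv_ne_zero (affineFactor_ne_zero hx _))
      · have h4 := hF o (spinAt (1 + 1) h3)
        rw [next_spinAt (0 + 1) h3, if_pos rfl, if_neg hne2, zero_add] at h4
        refine (mul_eq_zero.1 h4).resolve_left ?_
        exact mul_ne_zero (mul_ne_zero (crossSign_ne_zero _ _) (tvalInv_ne_zero hq _ _))
          (mul_ne_zero (nu_ne_zero _) (inv_ne_zero (affineFactor_ne_zero hy _)))
    · have hlast : (spinAt (0 + 1) h2 : Spin r n) = .inr ⟨n - 1, by omega⟩ := by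
        rw [← spinAt_last hn, spinAt_inj]; omega
      have pl : parity (spinAt (0 + 1) h2 : Spin r n) = 0 := by rw [hlast]; rfl
      have nl : nu (spinAt (0 + 1) h2 : Spin r n) = -1 := by rw [hlast]; rfl
      have hnl : next (spinAt (0 + 1) h2 : Spin r n) = o := next_spinAt_last 1 (by omega)
      have hA : ∀ z, affineFactor z o = 1 := fun z => affineFactor_spinAt z 0 h2
      have hB : ∀ z, affineFactor z (spinAt (0 + 1) h2 : Spin r n) = z := fun z =>
        affineFactor_spinAt_last z 1 (by omega)
      have h4 : _ = (0 : ℂ) := hE 0 h2 o o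
      have h5 : _ = (0 : ℂ) :=
        (opCoproductAct_f_mulVec_apply q x y (spinAt (0 + 1) h2) o o w).symm.trans
          (congrFun (hf (spinAt (0 + 1) h2) hne.symm) (o, o))
      rw [← ho] at h4
      simp only [if_true, hA, hB, hno, hnl, tval, tvalInv, if_neg hne, crossSign, po, no, pl,
        nl] at h4 h5
      generalize w (spinAt (0 + 1) h2, o) = α at *
      generalize w (o, spinAt (0 + 1) h2) = β at *
      have h4' : q * α - β = 0 := by
        rw [← h4]; simp; ring
      have h5' : -y * α + x * q * β = 0 := by
        have : -y * α + x * q * β = x * y * 0 := by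
          rw [← h5]; simp; field_simp
        simpa using this
      have hα : α = 0 := by
        refine (mul_eq_zero.1 ?_).resolve_left h
        linear_combination -h5' - x * q * h4'
      refine ⟨hα, ?_⟩
      rw [hα] at h4'
      linear_combination -h4'
  ext ⟨c, d⟩
  simp only [Pi.smul_apply, ket_apply, smul_eq_mul]
  by_cases hcd : c = o ∧ d = o
  · rw [hcd.1, hcd.2]; simp
  · rw [if_neg hcd, mul_zero]
    obtain ⟨i, hc, rfl⟩ := exists_spinAt_eq c
    obtain ⟨j, hd, rfl⟩ := exists_spinAt_eq d
    rcases i with _ | i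
    · rcases j with _ | j
      · exact absurd ⟨rfl, rfl⟩ hcd
      · rcases j with _ | j
        · exact hpair.2
        · exact hright (j + 1) hd _ (by simp [spinAt_inj])
    · by_cases hji : j = i
      · subst hji
        rcases j with _ | j
        · exact hpair.1
        · exact hright j hd _ (by simp only [ne_eq, spinAt_inj]; omega)
      · exact hleft i hc _ (by simpa [spinAt_inj] using hji)

/-- R-matrices of the quantum affine superalgebra on `V(x) ⊗ V(y)` are unique up to scalars when
`x ≠ q⁻² y`. -/
theorem IsAffineRMatrix.eq_smul_kojimaR {r n : ℕ} (hr : 0 < r) (hn : 0 < n) {q x y : ℂ}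
    (hq : q ≠ 0) (hx : x ≠ 0) (hy : y ≠ 0) (h : y - q ^ 2 * x ≠ 0) {R : End2 r n}
    (hR : IsAffineRMatrix q x y R) : ∃ c : ℂ, c ≠ 0 ∧ R = c • kojimaR r n (-q) (x / y) := by
  have hK := isAffineRMatrix_kojimaR (n := n) (by omega) hq hx hy h hr
  set K := kojimaR r n (-q) (x / y)
  set o : Spin r n := .inl ⟨0, hr⟩ with ho
  -- An operator that kills `o ⊗ o` under `Δ` kills its image by `R` under `Δᵒᵖ`.
  have hsing : R.mulVec (ket o o) = (R.mulVec (ket o o)) (o, o) • ket o o := by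
    apply eq_smul_ket_of_singular hr hn hq hx hy h
    · intro k hk
      rw [Matrix.mulVec_mulVec, ← hR.2, ← Matrix.mulVec_mulVec, coproductAct_e_ket,
        if_neg (Ne.symm hk), if_neg (Ne.symm hk)]
      simp
    · intro k hk
      rw [Matrix.mulVec_mulVec, ← hR.2, ← Matrix.mulVec_mulVec, coproductAct_f_ket,
        if_neg (Ne.symm hk), if_neg (Ne.symm hk)]
      simp
  have hKo : K.mulVec (ket o o) = -ket o o := by
    ext ⟨c, d⟩
    rw [mulVec_ket_apply]
    simp only [K, kojimaR, Matrix.of_apply, if_true, Pi.neg_apply, ket_apply, Prod.mk.injEq, ho]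
    split_ifs <;> simp
  set c := (R.mulVec (ket o o)) (o, o)
  -- Kojima's matrix has eigenvalue `-1` on `o ⊗ o`, hence the plus sign. The kernel of this
  -- combination is stable under `Δ` and contains the cyclic vector.
  have hzero : R + c • K = 0 := by
    apply end2_ext
    intro a b
    rw [Matrix.zero_mulVec]
    refine ket_mem_of_coproductAct_stable hr hn hq h (LinearMap.ker (R + c • K).mulVecLin)
      ?_ ?_ a b
    · intro X w hw
      rw [LinearMap.mem_ker, Matrix.mulVecLin_apply] at hw ⊢
      rw [Matrix.mulVec_mulVec, Matrix.add_mul, Matrix.smul_mul, hR.2, hK.2, ← Matrix.mul_smul,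
        ← Matrix.mul_add, ← Matrix.mulVec_mulVec, hw, Matrix.mulVec_zero]
    · rw [LinearMap.mem_ker, Matrix.mulVecLin_apply, Matrix.add_mulVec, Matrix.smul_mulVec, hKo,
        smul_neg, ← hsing, add_neg_cancel]
  have hRK : R = (-c) • K := by
    rw [neg_smul]
    exact eq_neg_of_add_eq_zero_left hzero
  refine ⟨-c, fun hc => hR.1 ?_, hRK⟩
  rw [hRK, hc, zero_smul]

/-! ### The twisting function and the R-matrix of the model -/

/-- Distinct scolors stay distinct modulo `n`, so the relation `g(a) g(-a) = v` applies to their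
difference. -/
theorem natCast_sub_ne_zero {n : ℕ} {a b : Fin n} (h : a ≠ b) :
    ((b : ℕ) : ZMod n) - ((a : ℕ) : ZMod n) ≠ 0 := by
  rw [sub_ne_zero, Ne, ZMod.natCast_eq_natCast_iff, Nat.ModEq, Nat.mod_eq_of_lt a.2,
    Nat.mod_eq_of_lt b.2]
  exact fun e => h (Fin.ext e.symm)

theorem phi_self {r n : ℕ} (s : ℂ) (g : ZMod n → ℂ) (a : Spin r n) : phi s g a a = 1 := by
  rcases a with a | a <;> simp [phi]

theorem phi_mul_phi {r n : ℕ} {v s : ℂ} (hv : v ≠ 0) (hs : s ^ 2 = v) {g : ZMod n → ℂ}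
    (hg : ∀ a : ZMod n, a ≠ 0 → g a * g (-a) = v) (a b : Spin r n) :
    phi s g a b * phi s g b a = 1 := by
  have hs0 : s ≠ 0 := by rintro rfl; exact hv (by rw [← hs]; simp)
  by_cases hab : a = b
  · rw [hab, phi_self, mul_one]
  rcases a with a | a <;> rcases b with b | b
  · have hab' : a ≠ b := fun e => hab (by rw [e])
    rcases lt_or_gt_of_ne hab' with h | h <;>
      simp only [phi, if_pos h, if_neg h.not_gt] <;> field_simp
  · simp [phi, hs0]
  · simp [phi, hs0]
  · have hab' : a ≠ b := fun e => hab (by rw [e])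
    have h1 := hg _ (natCast_sub_ne_zero hab')
    rw [neg_sub] at h1
    simp only [phi, if_neg hab', if_neg hab'.symm]
    rw [div_mul_div_comm, h1, ← sq, hs, div_self hv]

/-- A rescaling by `φ` of an operator mapping each `v_a ⊗ v_b` into the span of `v_a ⊗ v_b` and
`v_b ⊗ v_a` is a Drinfeld twist. -/
theorem isDrinfeldTwist_rescale {r n : ℕ} {φ : Spin r n → Spin r n → ℂ}
    (hφ : ∀ a b, φ a b * φ b a = 1) (hφ1 : ∀ a, φ a a = 1) {R : End2 r n}
    (hR : ∀ out inp, out ≠ inp → out ≠ inp.swap → R out inp = 0) :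
    IsDrinfeldTwist φ R (rescale φ R) := by
  choose σ hσ using fun a b : Spin r n => IsSquare.exists_sq _ (IsAlgClosed.exists_eq_mul_self (φ a b))
  have hφ0 : ∀ a b, φ a b ≠ 0 := fun a b => left_ne_zero_of_mul_eq_one (hφ a b)
  have hσ0 : ∀ a b, σ a b ≠ 0 := fun a b h0 => hφ0 a b (by rw [hσ, h0]; simp)
  -- As `f(a,b) = f(b,a)⁻¹`, the condition `φ(a,b) = f(b,a)/f(a,b)` reads `φ(a,b) = f(b,a)²`. One
  -- root is chosen per unordered pair, because independent choices for the two orders could violate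
  -- `F F₂₁ = 1` by a sign.
  let f : Spin r n → Spin r n → ℂ := fun a b =>
    if a = b then 1 else if pos a < pos b then (σ a b)⁻¹ else σ b a
  have hf : ∀ a b, f a b * f b a = 1 := by
    intro a b
    by_cases hab : a = b
    · simp [f, hab]
    · rcases lt_or_gt_of_ne (pos_injective.ne hab) with h | h
      · simp [f, hab, Ne.symm hab, h, h.not_gt, hσ0]
      · simp [f, hab, Ne.symm hab, h, h.not_gt, hσ0]
  have hf0 : ∀ a b, f a b ≠ 0 := fun a b => left_ne_zero_of_mul_eq_one (hf a b)
  have hfφ : ∀ a b, φ a b = f b a / f a b := by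
    intro a b
    by_cases hab : a = b
    · simp [f, hab, hφ1]
    · rcases lt_or_gt_of_ne (pos_injective.ne hab) with h | h
      · simp [f, hab, Ne.symm hab, h, h.not_gt, hσ a b, sq]
      · simp only [f, if_neg hab, if_neg (Ne.symm hab), if_pos h, if_neg h.not_gt]
        have h1 := hφ a b
        have h2 := hσ0 b a
        rw [hσ b a] at h1
        field_simp
        linear_combination h1
  refine ⟨f, hf, hfφ, ?_⟩
  ext ⟨c, d⟩ ⟨a, b⟩
  have hinv : (Matrix.diagonal fun p : Spin r n × Spin r n => f p.1 p.2)⁻¹ =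
      Matrix.diagonal fun p => f p.2 p.1 := by
    apply Matrix.inv_eq_right_inv
    rw [Matrix.diagonal_mul_diagonal, ← Matrix.diagonal_one]
    exact congrArg _ (funext fun p => hf _ _)
  rw [hinv, Matrix.mul_diagonal, Matrix.diagonal_mul]
  simp only [rescale, Matrix.of_apply]
  by_cases h1 : (c, d) = (a, b)
  · obtain ⟨rfl, rfl⟩ := Prod.mk.inj h1
    rw [if_pos rfl, hfφ]
    have := hf c d
    have h0 := hf0 c d
    field_simp
    linear_combination -R (c, d) (c, d) * f d c * this
  · rw [if_neg h1]
    by_cases h2 : (c, d) = (a, b).swap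
    -- A swap entry is multiplied by `f(d,c) f(c,d) = 1`.
    · obtain ⟨rfl, rfl⟩ := Prod.mk.inj h2
      have := hf c d
      linear_combination -R (c, d) (d, c) * this
    · rw [hR _ _ h1 h2]
      simp

theorem ungrade_smul {r n : ℕ} (c : ℂ) (R : End2 r n) : ungrade (c • R) = c • ungrade R := by
  ext p q
  simp only [ungrade, Matrix.of_apply, Matrix.smul_apply, smul_eq_mul]
  split_ifs <;> ring

theorem ungrade_kojimaR_eq_zero {r n : ℕ} (q z : ℂ) (out inp : Spin r n × Spin r n)
    (h1 : out ≠ inp) (h2 : out ≠ inp.swap) : ungrade (kojimaR r n q z) out inp = 0 := by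
  simp [ungrade, kojimaR, h1, h2]

/-! ### Comparison of the weights of the model with Kojima's -/

theorem changeBasis_apply {r n : ℕ} {zi zj : ℂ} (hzi : zi ≠ 0) (hzj : zj ≠ 0) (R : End2 r n)
    (a b c d : Spin r n) :
    changeBasis zi zj R (c, d) (a, b) =
      (basisScale ((n : ℤ) - 1) zi c * basisScale ((n : ℤ) - 1) zj d)⁻¹ * R (c, d) (a, b) *
        (basisScale ((n : ℤ) - 1) zi a * basisScale ((n : ℤ) - 1) zj b) := by
  have h0 : ∀ (z : ℂ), z ≠ 0 → ∀ a : Spin r n, basisScale ((n : ℤ) - 1) z a ≠ 0 := by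
    intro z hz a
    rcases a with a | a <;> simp [basisScale, hz, zpow_ne_zero]
  have hinv : (Matrix.diagonal fun p : Spin r n × Spin r n =>
      basisScale ((n : ℤ) - 1) zi p.1 * basisScale ((n : ℤ) - 1) zj p.2)⁻¹ =
      Matrix.diagonal fun p =>
        (basisScale ((n : ℤ) - 1) zi p.1 * basisScale ((n : ℤ) - 1) zj p.2)⁻¹ := by
    apply Matrix.inv_eq_right_inv
    rw [Matrix.diagonal_mul_diagonal, ← Matrix.diagonal_one]
    exact congrArg _ (funext fun p => mul_inv_cancel₀ (mul_ne_zero (h0 _ hzi _) (h0 _ hzj _)))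
  simp only [changeBasis]
  rw [hinv, Matrix.mul_diagonal, Matrix.diagonal_mul]

/-- At `w = n - 1` the exponent `w - x + 1 - n` collapses to `-x`. -/
theorem basisScale_inr {r n : ℕ} (z : ℂ) (x : Fin n) :
    basisScale ((n : ℤ) - 1) z (.inr x : Spin r n) = (z ^ (x : ℕ))⁻¹ := by
  rw [basisScale, ← zpow_natCast, ← zpow_neg]
  congr 1
  ring

theorem basisScale_inl {r n : ℕ} (w : ℤ) (z : ℂ) (a : Fin r) :
    basisScale w z (.inl a : Spin r n) = 1 := rfl

theorem pos_inl_lt_inl {r n : ℕ} (a b : Fin r) :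
    pos (.inl a : Spin r n) < pos (.inl b) ↔ a < b := by
  simp only [pos, finSumFinEquiv_apply_left, Fin.lt_def, Fin.val_castAdd]

theorem pos_inr_lt_inr {r n : ℕ} (a b : Fin n) :
    pos (.inr a : Spin r n) < pos (.inr b) ↔ a < b := by
  simp only [pos, finSumFinEquiv_apply_right, Fin.lt_def, Fin.val_natAdd, add_lt_add_iff_left]

theorem pos_inl_lt_inr {r n : ℕ} (a : Fin r) (b : Fin n) :
    pos (.inl a : Spin r n) < pos (.inr b) := by
  simp only [pos, finSumFinEquiv_apply_left, finSumFinEquiv_apply_right, Fin.lt_def,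
    Fin.val_castAdd, Fin.val_natAdd]
  omega

theorem changeBasis_fusedR {r n : ℕ} {v s : ℂ} (hv : v ≠ 0) (hs : s ^ 2 = v) (g : ZMod n → ℂ)
    {zi zj : ℂ} (hzi : zi ≠ 0) (hzj : zj ≠ 0) (hz : zi ^ n ≠ v * zj ^ n) :
    changeBasis zi zj (fusedR r v g zi zj) =
      rescale (phi s g)
        ((zi ^ n - v * zj ^ n) • ungrade (kojimaR r n (1 / s) (zi ^ n / zj ^ n))) := by
  have hs0 : s ≠ 0 := by rintro rfl; exact hv (by rw [← hs]; simp)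
  have hj : zj ^ n ≠ 0 := pow_ne_zero _ hzj
  -- Kojima's denominator is the scalar prefactor up to `-1/(v ζ_j)`, so the two cancel in every
  -- weight.
  have hq : 1 - (1 / s) ^ 2 * (zi ^ n / zj ^ n) = -(zi ^ n - v * zj ^ n) / (v * zj ^ n) := by
    rw [← hs]; field_simp; ring
  have hd : zi ^ n - v * zj ^ n ≠ 0 := sub_ne_zero.2 hz
  ext ⟨c, d⟩ ⟨a, b⟩
  rw [changeBasis_apply hzi hzj]
  simp only [fusedR, rescale, Matrix.of_apply, Matrix.smul_apply, ungrade, kojimaR, hq,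
    Prod.mk.injEq, Prod.swap_prod_mk, smul_eq_mul]
  subst hs
  generalize hx : zi ^ n = x at *
  generalize hy : zj ^ n = y at *
  clear hz hq
  generalize hD : x - s ^ 2 * y = D at *
  rcases a with a | a <;> rcases b with b | b <;> rcases c with c | c <;> rcases d with d | d <;>
    simp only [fusedWeight, basisScale_inl, basisScale_inr, reduceCtorEq, false_and, and_false,
      if_false, mul_zero, zero_mul, Sum.inl.injEq, Sum.inr.injEq, Sum.isLeft_inl, Sum.isLeft_inr,
      and_true, Bool.false_eq_true, if_true, neg_zero, ite_self, hx, hy, parity, phi,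
      pos_inl_lt_inl, pos_inr_lt_inr, pos_inl_lt_inr, (pos_inl_lt_inr _ _).not_gt, mul_one, one_mul,
      inv_one, pow_zero, pow_one, div_pow]
  · by_cases hab : a = b
    · subst hab
      by_cases h1 : c = a ∧ d = a
      · obtain ⟨rfl, rfl⟩ := h1
        simp [hD]
      · simp [h1]
    · by_cases h1 : c = a ∧ d = b
      · obtain ⟨rfl, rfl⟩ := h1
        simp only [if_neg hab, and_self, if_true]
        rcases lt_or_gt_of_ne hab with h | h
        · simp only [if_pos h, if_neg h.not_gt]
          field_simp
          ring
        · simp only [if_pos h, if_neg h.not_gt]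
          field_simp
          ring
      · by_cases h2 : c = b ∧ d = a
        · obtain ⟨rfl, rfl⟩ := h2
          simp only [if_neg hab, if_neg h1, and_self, if_true]
          rcases lt_or_gt_of_ne hab with h | h
          · simp only [if_pos h, if_neg h.not_gt]
            field_simp
            ring
          · simp only [if_pos h, if_neg h.not_gt]
            field_simp
            ring
        · simp [hab, h1, h2]
  · by_cases h1 : c = a ∧ d = b
    · obtain ⟨rfl, rfl⟩ := h1
      simp only [and_self, if_true]
      field_simp
      ring
    · simp [h1]
  · by_cases h1 : c = b ∧ d = a
    · obtain ⟨rfl, rfl⟩ := h1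
      simp only [and_self, if_true]
      field_simp
      ring
    · simp [h1]
  · by_cases h1 : c = b ∧ d = a
    · obtain ⟨rfl, rfl⟩ := h1
      simp only [and_self, if_true]
      field_simp
      ring
    · simp [h1]
  · by_cases h1 : c = a ∧ d = b
    · obtain ⟨rfl, rfl⟩ := h1
      simp only [and_self, if_true]
      field_simp
      ring
    · simp [h1]
  · by_cases hab : a = b
    · subst hab
      by_cases h1 : c = a ∧ d = a
      · obtain ⟨rfl, rfl⟩ := h1
        simp only [and_self, if_true]
        field_simp
      · simp [h1]
    · by_cases h1 : c = a ∧ d = b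
      · obtain ⟨rfl, rfl⟩ := h1
        simp only [if_neg hab, and_self, if_true]
        field_simp
        ring
      · by_cases h2 : c = b ∧ d = a
        · obtain ⟨rfl, rfl⟩ := h2
          -- Splitting the integer power of `z_j/z_i` lets it cancel against the scaling factors of
          -- the four edges.
          simp only [if_neg hab, if_neg h1, and_self, if_true, zpow_sub₀ (div_ne_zero hzj hzi),
            zpow_natCast, div_pow]
          rcases lt_or_gt_of_ne hab with h | h
          · simp only [if_pos h, if_neg h.not_gt]
            field_simp
            ring
          · simp only [if_pos h, if_neg h.not_gt]
            field_simp
            ring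
        · simp [hab, h1, h2]

end

end MetaplecticIce

open MetaplecticIce in
theorem proposition2p4 (r n : ℕ) (hr : 0 < r) (hn : 0 < n)
    (v s : ℂ) (hv : v ≠ 0) (hs : s ^ 2 = v)
    (g : ZMod n → ℂ) (hg0 : g 0 = -v) (hg : ∀ a : ZMod n, a ≠ 0 → g a * g (-a) = v)
    (zi zj : ℂ) (hzi : zi ≠ 0) (hzj : zj ≠ 0) (hz : zi ^ n ≠ v * zj ^ n) :
    -- the twisting function
    (∀ a b : Spin r n, phi s g a b * phi s g b a = 1) ∧
    -- the R-matrix of the model, in the new basis, is the `φ`-twist of Kojima's R-matrix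
    changeBasis zi zj (fusedR r v g zi zj) =
      rescale (phi s g)
        ((zi ^ n - v * zj ^ n) • ungrade (kojimaR r n (1 / s) (zi ^ n / zj ^ n))) ∧
    IsDrinfeldTwist (phi s g)
      ((zi ^ n - v * zj ^ n) • ungrade (kojimaR r n (1 / s) (zi ^ n / zj ^ n)))
      (changeBasis zi zj (fusedR r v g zi zj)) ∧
    -- the evaluation modules of `U_{1/s}` have an R-matrix, given by Kojima's formula with the
    -- sign of the diagonal weights with distinct spins (the part odd in `q`) reversed
    IsAffineRMatrix (1 / s) (zi ^ n) (zj ^ n) (kojimaR r n (-(1 / s)) (zi ^ n / zj ^ n)) ∧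
    -- and, whichever R-matrix of `U_{1/s}` one takes, a multiple of it twists to that of the model
    ∀ R : End2 r n, IsAffineRMatrix (1 / s) (zi ^ n) (zj ^ n) R →
      ∃ c : ℂ, c ≠ 0 ∧
        IsDrinfeldTwist (phi (-s) g) (c • ungrade R) (changeBasis zi zj (fusedR r v g zi zj)) := by
  have hs0 : s ≠ 0 := by rintro rfl; exact hv (by rw [← hs]; simp)
  have hs' : (-s) ^ 2 = v := by rw [neg_sq, hs]
  have hi : zi ^ n ≠ 0 := pow_ne_zero _ hzi
  have hj : zj ^ n ≠ 0 := pow_ne_zero _ hzj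
  have hd : zi ^ n - v * zj ^ n ≠ 0 := sub_ne_zero.2 hz
  have hq : (1 / s) ≠ 0 := one_div_ne_zero hs0
  have hqd : zj ^ n - (1 / s) ^ 2 * zi ^ n ≠ 0 := by
    intro h0
    apply hd
    rw [← hs]
    field_simp at h0
    linear_combination -h0
  -- Stated for both square roots of `v`: `s` serves the model's own twist, `-s` the comparison with
  -- the quantum group.
  have htwist : ∀ t : ℂ, t ^ 2 = v → IsDrinfeldTwist (phi t g)
      ((zi ^ n - v * zj ^ n) • ungrade (kojimaR r n (1 / t) (zi ^ n / zj ^ n)))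
      (changeBasis zi zj (fusedR r v g zi zj)) := by
    intro t ht
    rw [changeBasis_fusedR hv ht g hzi hzj hz]
    refine isDrinfeldTwist_rescale (phi_mul_phi hv ht hg) (phi_self t g) fun out inp h1 h2 => ?_
    rw [Matrix.smul_apply, ungrade_kojimaR_eq_zero _ _ _ _ h1 h2, smul_zero]
  refine ⟨phi_mul_phi hv hs hg, changeBasis_fusedR hv hs g hzi hzj hz, htwist s hs,
    isAffineRMatrix_kojimaR (by omega) hq hi hj hqd hr, fun R hR => ?_⟩
  obtain ⟨c, hc, rfl⟩ := hR.eq_smul_kojimaR hr hn hq hi hj hqd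
  -- This constant trades the scalar of the given R-matrix for the prefactor of the model.
  refine ⟨(zi ^ n - v * zj ^ n) / c, div_ne_zero hd hc, ?_⟩
  rw [ungrade_smul, smul_smul, div_mul_cancel₀ _ hc, ← div_neg]
  exact htwist (-s) hs'
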